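/- Let $\mathcal{M}$ be a connected Riemann surface with non-empty boundary, in the following sense: $\mathcal{M}'$ is a Riemann surface without boundary, $\mathrm{Int}(\mathcal{M})\subseteq\mathcal{M}'$ is a non-empty connected open subset, $\mathcal{M}$ is its closure in $\mathcal{M}'$, and $\partial(\mathcal{M})=\mathcal{M}\setminus\mathrm{Int}(\mathcal{M})$ is its topological frontier, with $\partial(\mathcal{M})\neq\emptyset$. (No regularity of the boundary is needed; typically it is a locally finite family of pairwise disjoint closed curves, some of which may be isolated points.) Let $Y=(Y_1,Y_2,Y_3):\mathcal{M}\to\mathbb{R}^3$ be a conformal minimal immersion, that is, a continuous map which on $\mathrm{Int}(\mathcal{M})$ is a smooth conformal immersion with zero mean curvature. Let $\pi_0:\mathbb{R}^3\to\{x_3=0\}$ be the orthogonal projection, and suppose that $\pi_0\circ Y:\mathcal{M}\to\{x_3=0\}$ is proper. Let $N=(N_1,N_2,N_3):\mathrm{Int}(\mathcal{M})\to\mathbb{S}^2$ be the Gauss map (continuous unit normal) of $Y$, and assume that the $1$-form $\psi:=N_2\,dY_1-N_1\,dY_2$ is exact on $\mathcal{M}$, that is, there is a continuous function $P:\mathcal{M}\to\mathbb{R}$,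 differentiable on $\mathrm{Int}(\mathcal{M})$, with $dP=\psi$ there; write $\int_{p_0}^p\psi:=P(p)-P(p_0)$. If there are $p_0\in\mathrm{Int}(\mathcal{M})$, $\varepsilon>0$ and $C\in\mathbb{R}$ such that $$\Bigl|\int_{p_0}^p\psi+C\Bigr|\le\|\pi_0(Y(p))\|-\varepsilon\qquad\text{for all }p\in\mathcal{M},$$ where $\|\cdot\|$ is the Euclidean norm, then $\mathcal{M}$ is relative parabolic: every bounded continuous function $f:\mathcal{M}\to\mathbb{R}$ that is harmonic on $\mathrm{Int}(\mathcal{M})$ and vanishes on $\partial(\mathcal{M})$ is identically zero. -/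

import Mathlib

open scoped ContDiff Manifold

noncomputable section

namespace BorderedSurface

/-!
A Riemann surface with boundary is given by an open subset `U` (its interior) of a Riemann
surface `M` without boundary: the surface itself is `closure U`, its boundary is `frontier U`.
A boundary component may thus be an isolated point of `frontier U`.
Functions on the surface are functions on `M`, of which only the restriction to `closure U`
matters.
-/

/-- Euclidean three-space. -/
abbrev E3 : Type := EuclideanSpace ℝ (Fin 3)

/-- The orthogonal projection onto the horizontal plane `{x₃ = 0}`, which is identified with `ℝ²`. -/
def horizontalProj (x : E3) : EuclideanSpace ℝ (Fin 2) := !₂[x 0, x 1]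

/-- The partial derivative in the direction of the first coordinate `u` of `z = u + i v`. -/
def partialU (X : ℂ → E3) (z : ℂ) : E3 := fderiv ℝ X z 1

/-- The partial derivative in the direction of the second coordinate `v` of `z = u + i v`. -/
def partialV (X : ℂ → E3) (z : ℂ) : E3 := fderiv ℝ X z Complex.I

/-- `ν` is a unit normal vector at `z` of the parametrized surface `X`. -/
def IsUnitNormal (X : ℂ → E3) (z : ℂ) (ν : E3) : Prop :=
  ‖ν‖ = 1 ∧ inner ℝ ν (partialU X z) = 0 ∧ inner ℝ ν (partialV X z) = 0

/-- The mean curvature `(eG - 2fF + gE) / (2 (EG - F²))` at `z` of the parametrized surface `X`,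
with respect to the unit normal vector `ν`. -/
def meanCurvature (X : ℂ → E3) (z : ℂ) (ν : E3) : ℝ :=
  let E : ℝ := inner ℝ (partialU X z) (partialU X z)
  let F : ℝ := inner ℝ (partialU X z) (partialV X z)
  let G : ℝ := inner ℝ (partialV X z) (partialV X z)
  let e : ℝ := inner ℝ (iteratedFDeriv ℝ 2 X z ![1, 1]) ν
  let f : ℝ := inner ℝ (iteratedFDeriv ℝ 2 X z ![1, Complex.I]) ν
  let g : ℝ := inner ℝ (iteratedFDeriv ℝ 2 X z ![Complex.I, Complex.I]) ν
  (e * G - 2 * f * F + g * E) / (2 * (E * G - F ^ 2))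

variable {M : Type*} [TopologicalSpace M] [ChartedSpace ℂ M]

/-- A conformal minimal immersion of the surface `closure U` in `ℝ³`: continuous on the surface,
and, in its interior, smooth, conformal (so its differential is injective) and of zero mean
curvature. No regularity is asked for at boundary points. -/
structure IsConformalMinimalImmersion (U : Set M) (Y : M → E3) : Prop where
  continuousOn : ContinuousOn Y (closure U)
  smooth : ∀ e ∈ atlas ℂ M, ContDiffOn ℝ ∞ (Y ∘ e.symm) (e.target ∩ e.symm ⁻¹' U)
  conformal : ∀ e ∈ atlas ℂ M, ∀ p ∈ e.source ∩ U, ConformalAt (Y ∘ e.symm) (e p)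
  minimal : ∀ e ∈ atlas ℂ M, ∀ p ∈ e.source ∩ U, ∀ ν : E3,
    IsUnitNormal (Y ∘ e.symm) (e p) ν → meanCurvature (Y ∘ e.symm) (e p) ν = 0

/-- `N` is a Gauss map of `Y`: a continuous field of unit normal vectors in the interior. -/
structure IsGaussMap (U : Set M) (Y N : M → E3) : Prop where
  continuousOn : ContinuousOn N U
  unitNormal : ∀ e ∈ atlas ℂ M, ∀ p ∈ e.source ∩ U, IsUnitNormal (Y ∘ e.symm) (e p) (N p)

/-- The 1-form `ψ = N₂ dY₁ - N₁ dY₂` at the point `p`, read in the chart `e`. -/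
def psi (Y N : M → E3) (e : OpenPartialHomeomorph M ℂ) (p : M) : ℂ →L[ℝ] ℝ :=
  N p 1 • fderiv ℝ (fun z => Y (e.symm z) 0) (e p)
    - N p 0 • fderiv ℝ (fun z => Y (e.symm z) 1) (e p)

/-- `P` is a primitive on the surface of `ψ = N₂ dY₁ - N₁ dY₂`: `dP = ψ` in the interior, and
`P` is continuous up to the boundary. Then `P p - P p₀` is the integral of `ψ` from `p₀` to `p`. -/
structure IsPrimitivePsi (U : Set M) (Y N : M → E3) (P : M → ℝ) : Prop where
  continuousOn : ContinuousOn P (closure U)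
  hasFDerivAt : ∀ e ∈ atlas ℂ M, ∀ p ∈ e.source ∩ U,
    HasFDerivAt (P ∘ e.symm) (psi Y N e p) (e p)

/-- `f` is harmonic on `U`: harmonic in every holomorphic coordinate. -/
def IsHarmonicOn (f : M → ℝ) (U : Set M) : Prop :=
  ∀ e ∈ atlas ℂ M, ∀ p ∈ e.source ∩ U, InnerProductSpace.HarmonicAt (f ∘ e.symm) (e p)

/-- The surface `closure U` is relative parabolic: the only bounded continuous function on it that
is harmonic in the interior and vanishes on the boundary is zero. -/
def IsRelativeParabolic (U : Set M) : Prop :=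
  ∀ f : M → ℝ, ContinuousOn f (closure U) → (∃ B : ℝ, ∀ p ∈ closure U, |f p| ≤ B) →
    IsHarmonicOn f U → (∀ p ∈ frontier U, f p = 0) → ∀ p ∈ closure U, f p = 0

end BorderedSurface

end

/-! Since `ψ` is, up to orientation, the conjugate differential of `Y₃`, its primitive `Q` is
harmonic and `(Y₁, Y₂, Q)` is a harmonic map, conformal (possibly degenerate) into Lorentz-Minkowski
space. There `q = Y₁² + Y₂² - Q²` satisfies `Δq = 4l`, with `l ≥ 0` the conformal factor, and `|∇q|²
≥ 4lq` by `lorentz_tangent_ge`, so `log q` is superharmonic where `q > 0`. The growth bound gives `q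
≥ 2εr - ε²` with `r = ‖π₀ ∘ Y‖ ≥ ε`. Hence `log q` is bounded below, and properness makes it tend to
infinity at the ends. A bounded harmonic function minus `δ log q` then obeys the maximum principle;
letting `δ` be small gives parabolicity. The term `η (Y₁² + Y₂²)` makes the subharmonicity strict,
so the second-order test at a maximum suffices (`not_isLocalMax_sub_log`). The global argument is
`nonpos_of_frontier_nonpos`. -/

namespace BorderedSurface

open Filter Topology

/-! ### Second-order calculus in one real variable. -/

/-- `g` is differentiable near `0` with `g' 0 = a`, and `g'` has derivative `b` at `0`. -/
def HasTwoJet (g : ℝ → ℝ) (a b : ℝ) : Prop :=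
  ∃ g' : ℝ → ℝ, (∀ᶠ t in 𝓝 0, HasDerivAt g (g' t) t) ∧ g' 0 = a ∧ HasDerivAt g' b 0

namespace HasTwoJet

variable {g h : ℝ → ℝ} {a b c d : ℝ}

theorem add (hg : HasTwoJet g a b) (hh : HasTwoJet h c d) :
    HasTwoJet (fun t => g t + h t) (a + c) (b + d) := by
  obtain ⟨g', h1, rfl, h2⟩ := hg
  obtain ⟨k', h3, rfl, h4⟩ := hh
  exact ⟨fun t => g' t + k' t, by filter_upwards [h1, h3] with t ht ht' using ht.add ht',
    rfl, h2.add h4⟩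

theorem const_mul (r : ℝ) (hg : HasTwoJet g a b) :
    HasTwoJet (fun t => r * g t) (r * a) (r * b) := by
  obtain ⟨g', h1, rfl, h2⟩ := hg
  exact ⟨fun t => r * g' t, by filter_upwards [h1] with t ht using ht.const_mul r,
    rfl, h2.const_mul r⟩

theorem sub (hg : HasTwoJet g a b) (hh : HasTwoJet h c d) :
    HasTwoJet (fun t => g t - h t) (a - c) (b - d) := by
  simpa [sub_eq_add_neg] using hg.add (hh.const_mul (-1))

theorem sq (hg : HasTwoJet g a b) :
    HasTwoJet (fun t => g t ^ 2) (2 * (g 0 * a)) (2 * (a ^ 2 + g 0 * b)) := by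
  obtain ⟨g', h1, rfl, h2⟩ := hg
  refine ⟨fun t => 2 * (g t * g' t), ?_, rfl, ?_⟩
  · filter_upwards [h1] with t ht
    refine (ht.pow 2).congr_deriv ?_
    simp; ring
  · refine ((h1.self_of_nhds.mul h2).const_mul 2).congr_deriv ?_
    ring

theorem log (hg : HasTwoJet g a b) (h0 : g 0 ≠ 0) :
    HasTwoJet (fun t => Real.log (g t)) (a / g 0) ((b * g 0 - a ^ 2) / g 0 ^ 2) := by
  obtain ⟨g', h1, rfl, h2⟩ := hg
  refine ⟨fun t => g' t / g t, ?_, rfl, ?_⟩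
  · filter_upwards [h1, h1.self_of_nhds.continuousAt.eventually_ne h0] with t ht ht'
    exact ht.log ht'
  · refine (h2.div h1.self_of_nhds h0).congr_deriv ?_
    ring

/-- The necessary second order condition at a local maximum. -/
theorem nonpos_of_isLocalMax (hg : HasTwoJet g a b) (hmax : IsLocalMax g 0) : b ≤ 0 := by
  obtain ⟨g', h1, -, h2⟩ := hg
  by_contra! hb
  have hd : deriv g =ᶠ[𝓝 0] g' := by filter_upwards [h1] with t ht using ht.deriv
  -- If `b > 0`, the point is also a local minimum, so `g` is locally constant and `b = 0`.
  have hmin : IsLocalMin g 0 := by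
    refine isLocalMin_of_deriv_deriv_pos ?_ hmax.deriv_eq_zero h1.self_of_nhds.continuousAt
    rwa [hd.deriv_eq, h2.deriv]
  have hconst : g =ᶠ[𝓝 0] fun _ => g 0 := by
    filter_upwards [hmax, hmin] with t ht ht' using le_antisymm ht ht'
  have hd0 : deriv g =ᶠ[𝓝 0] fun _ => 0 := by
    filter_upwards [hconst.eventuallyEq_nhds] with t ht
    rw [ht.deriv_eq, deriv_const]
  have := (hd.symm.trans hd0).deriv_eq
  rw [h2.deriv, deriv_const] at this
  exact hb.ne' this

end HasTwoJet

/-! ### Restriction of functions on `ℂ` to real lines. -/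

section Lines

variable {F : Type*} [NormedAddCommGroup F] [NormedSpace ℝ F] {g : ℂ → F} {z : ℂ}

theorem hasDerivAt_line (z v : ℂ) (t : ℝ) : HasDerivAt (fun s : ℝ => z + s • v) v t := by
  simpa using ((hasDerivAt_id t).smul_const v).const_add z

theorem tendsto_line (z v : ℂ) : Tendsto (fun s : ℝ => z + s • v) (𝓝 0) (𝓝 z) := by
  simpa using (hasDerivAt_line z v 0).continuousAt.tendsto

theorem hasDerivAt_comp_line {g' : ℂ →L[ℝ] F} (v : ℂ) (t : ℝ) (h : HasFDerivAt g g' (z + t • v)) :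
    HasDerivAt (fun s : ℝ => g (z + s • v)) (g' v) t :=
  h.comp_hasDerivAt t (hasDerivAt_line z v t)

theorem hasDerivAt_fderiv_line (hg : ContDiffAt ℝ 2 g z) (v w : ℂ) :
    HasDerivAt (fun t : ℝ => fderiv ℝ g (z + t • v) w) (fderiv ℝ (fderiv ℝ g) z v w) 0 := by
  have h1 : DifferentiableAt ℝ (fderiv ℝ g) z :=
    (hg.fderiv_right (m := 1) (by norm_num)).differentiableAt (by norm_num)
  have h2 := hasDerivAt_comp_line (g := fderiv ℝ g) (z := z) v 0 (by simpa using h1.hasFDerivAt)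
  exact ((ContinuousLinearMap.apply ℝ F w).hasFDerivAt).comp_hasDerivAt (0 : ℝ) h2

theorem eventually_differentiableAt (hg : ContDiffAt ℝ 2 g z) :
    ∀ᶠ w in 𝓝 z, DifferentiableAt ℝ g w := by
  filter_upwards [hg.eventually (by simp)] with w hw using hw.differentiableAt (by norm_num)

theorem hasTwoJet_line {g : ℂ → ℝ} (hg : ContDiffAt ℝ 2 g z) (v : ℂ) :
    HasTwoJet (fun t => g (z + t • v)) (fderiv ℝ g z v) (fderiv ℝ (fderiv ℝ g) z v v) := by
  refine ⟨fun t => fderiv ℝ g (z + t • v) v, ?_, by simp, hasDerivAt_fderiv_line hg v v⟩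
  filter_upwards [(tendsto_line z v).eventually (eventually_differentiableAt hg)] with t ht
  exact hasDerivAt_comp_line v t ht.hasFDerivAt

theorem hasDerivAt_coord {f : ℝ → E3} {f' : E3} {t : ℝ} (h : HasDerivAt f f' t) (i : Fin 3) :
    HasDerivAt (fun s => f s i) (f' i) t :=
  ((EuclideanSpace.proj i : E3 →L[ℝ] ℝ).hasFDerivAt).comp_hasDerivAt t h

theorem fderiv_coord {X : ℂ → E3} {w : ℂ} (h : DifferentiableAt ℝ X w) (i : Fin 3) (v : ℂ) :
    fderiv ℝ (fun y => X y i) w v = fderiv ℝ X w v i := by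
  have := ((EuclideanSpace.proj i : E3 →L[ℝ] ℝ).hasFDerivAt).comp w h.hasFDerivAt
  exact congrArg (· v) this.fderiv

theorem hasTwoJet_coord_line {X : ℂ → E3} (hX : ContDiffAt ℝ 2 X z) (v : ℂ) (i : Fin 3) :
    HasTwoJet (fun t => X (z + t • v) i) (fderiv ℝ X z v i)
      (fderiv ℝ (fderiv ℝ X) z v v i) := by
  refine ⟨fun t => fderiv ℝ X (z + t • v) v i, ?_, by simp,
    hasDerivAt_coord (hasDerivAt_fderiv_line hX v v) i⟩
  filter_upwards [(tendsto_line z v).eventually (eventually_differentiableAt hX)] with t ht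
  exact hasDerivAt_coord (hasDerivAt_comp_line v t ht.hasFDerivAt) i

end Lines

/-! ### Euclidean and Lorentzian algebra of conformal frames. -/

section LinearAlgebra

variable {n₀ n₁ n₂ a₀ a₁ a₂ b₀ b₁ b₂ E : ℝ}

/-- The square of the triple product of a unit vector and two vectors of equal length `√E`, all
three being pairwise orthogonal. -/
theorem tripleProduct_sq (hn : n₀ ^ 2 + n₁ ^ 2 + n₂ ^ 2 = 1)
    (hna : n₀ * a₀ + n₁ * a₁ + n₂ * a₂ = 0) (hnb : n₀ * b₀ + n₁ * b₁ + n₂ * b₂ = 0)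
    (ha : a₀ ^ 2 + a₁ ^ 2 + a₂ ^ 2 = E) (hb : b₀ ^ 2 + b₁ ^ 2 + b₂ ^ 2 = E)
    (hab : a₀ * b₀ + a₁ * b₁ + a₂ * b₂ = 0) :
    (n₀ * (a₁ * b₂ - a₂ * b₁) + n₁ * (a₂ * b₀ - a₀ * b₂) + n₂ * (a₀ * b₁ - a₁ * b₀)) ^ 2
      = E ^ 2 := by
  have gram : (n₀ * (a₁ * b₂ - a₂ * b₁) + n₁ * (a₂ * b₀ - a₀ * b₂)
        + n₂ * (a₀ * b₁ - a₁ * b₀)) ^ 2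
      = (n₀ ^ 2 + n₁ ^ 2 + n₂ ^ 2) * (a₀ ^ 2 + a₁ ^ 2 + a₂ ^ 2) * (b₀ ^ 2 + b₁ ^ 2 + b₂ ^ 2)
        + 2 * (n₀ * a₀ + n₁ * a₁ + n₂ * a₂) * (n₀ * b₀ + n₁ * b₁ + n₂ * b₂)
          * (a₀ * b₀ + a₁ * b₁ + a₂ * b₂)
        - (n₀ ^ 2 + n₁ ^ 2 + n₂ ^ 2) * (a₀ * b₀ + a₁ * b₁ + a₂ * b₂) ^ 2
        - (a₀ ^ 2 + a₁ ^ 2 + a₂ ^ 2) * (n₀ * b₀ + n₁ * b₁ + n₂ * b₂) ^ 2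
        - (b₀ ^ 2 + b₁ ^ 2 + b₂ ^ 2) * (n₀ * a₀ + n₁ * a₁ + n₂ * a₂) ^ 2 := by ring
  rw [gram, hn, ha, hb, hab, hna, hnb]; ring

/-- Rotation by a right angle in the plane orthogonal to `n` is the cross product with `n`, up to
the orientation sign `s`: the vertical component. -/
theorem cross_vertical {s : ℝ} (hn : n₀ ^ 2 + n₁ ^ 2 + n₂ ^ 2 = 1)
    (hna : n₀ * a₀ + n₁ * a₁ + n₂ * a₂ = 0)
    (ha : a₀ ^ 2 + a₁ ^ 2 + a₂ ^ 2 = E) (hb : b₀ ^ 2 + b₁ ^ 2 + b₂ ^ 2 = E)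
    (hs : s ^ 2 = 1)
    (hdet : n₀ * (a₁ * b₂ - a₂ * b₁) + n₁ * (a₂ * b₀ - a₀ * b₂) + n₂ * (a₀ * b₁ - a₁ * b₀)
      = s * E) :
    n₀ * a₁ - n₁ * a₀ = s * b₂ := by
  -- This is `|n × a - s b|²`; since `⟨n × a, b⟩ = sE`, it expands to `E - 2s²E + s²E = 0`.
  have key : (n₁ * a₂ - n₂ * a₁ - s * b₀) ^ 2 + (n₂ * a₀ - n₀ * a₂ - s * b₁) ^ 2
      + (n₀ * a₁ - n₁ * a₀ - s * b₂) ^ 2 = 0 := by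
    have : (n₁ * a₂ - n₂ * a₁ - s * b₀) ^ 2 + (n₂ * a₀ - n₀ * a₂ - s * b₁) ^ 2
        + (n₀ * a₁ - n₁ * a₀ - s * b₂) ^ 2
        = (n₀ ^ 2 + n₁ ^ 2 + n₂ ^ 2) * (a₀ ^ 2 + a₁ ^ 2 + a₂ ^ 2)
          - (n₀ * a₀ + n₁ * a₁ + n₂ * a₂) ^ 2
          - 2 * s * (n₀ * (a₁ * b₂ - a₂ * b₁) + n₁ * (a₂ * b₀ - a₀ * b₂)
            + n₂ * (a₀ * b₁ - a₁ * b₀))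
          + s ^ 2 * (b₀ ^ 2 + b₁ ^ 2 + b₂ ^ 2) := by ring
    rw [this, hn, ha, hb, hna, hdet]
    linear_combination -E * hs
  have h2 : (n₀ * a₁ - n₁ * a₀ - s * b₂) ^ 2 = 0 := by
    nlinarith [sq_nonneg (n₁ * a₂ - n₂ * a₁ - s * b₀), sq_nonneg (n₂ * a₀ - n₀ * a₂ - s * b₁),
      sq_nonneg (n₀ * a₁ - n₁ * a₀ - s * b₂)]
  linarith [pow_eq_zero_iff (two_ne_zero) |>.mp h2]

/-- For a conformal frame `a, b` the quantity `E - a₂ ^ 2 - b₂ ^ 2` is nonnegative. -/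
theorem conformal_vertical_le (hE : 0 < E)
    (ha : a₀ ^ 2 + a₁ ^ 2 + a₂ ^ 2 = E) (hb : b₀ ^ 2 + b₁ ^ 2 + b₂ ^ 2 = E)
    (hab : a₀ * b₀ + a₁ * b₁ + a₂ * b₂ = 0) : a₂ ^ 2 + b₂ ^ 2 ≤ E := by
  -- The right side is the squared vertical component of `a × b`.
  have key : E * (E - (a₂ ^ 2 + b₂ ^ 2)) = (a₀ * b₁ - a₁ * b₀) ^ 2 := by
    have h1 : a₀ ^ 2 + a₁ ^ 2 = E - a₂ ^ 2 := by linarith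
    have h2 : b₀ ^ 2 + b₁ ^ 2 = E - b₂ ^ 2 := by linarith
    have h3 : a₀ * b₀ + a₁ * b₁ = -(a₂ * b₂) := by linarith
    have : (a₀ * b₁ - a₁ * b₀) ^ 2
        = (a₀ ^ 2 + a₁ ^ 2) * (b₀ ^ 2 + b₁ ^ 2) - (a₀ * b₀ + a₁ * b₁) ^ 2 := by ring
    rw [this, h1, h2, h3]; ring
  have := nonneg_of_mul_nonneg_right (key ▸ sq_nonneg (a₀ * b₁ - a₁ * b₀)) hE
  linarith

/-- In Lorentz-Minkowski space the squared length of `(x, y, p)` is at most that of its component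
tangent to the spacelike plane spanned by the conformal frame `(v₀, v₁, v₂)`, `(w₀, w₁, w₂)`. -/
theorem lorentz_tangent_ge {x y p v₀ v₁ v₂ w₀ w₁ w₂ l : ℝ} (hl : 0 ≤ l)
    (hv : v₀ ^ 2 + v₁ ^ 2 - v₂ ^ 2 = l) (hw : w₀ ^ 2 + w₁ ^ 2 - w₂ ^ 2 = l)
    (hvw : v₀ * w₀ + v₁ * w₁ - v₂ * w₂ = 0) :
    l * (x ^ 2 + y ^ 2 - p ^ 2)
      ≤ (x * v₀ + y * v₁ - p * v₂) ^ 2 + (x * w₀ + y * w₁ - p * w₂) ^ 2 := by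
  rcases hl.eq_or_lt with rfl | hl
  · nlinarith [sq_nonneg (x * v₀ + y * v₁ - p * v₂), sq_nonneg (x * w₀ + y * w₁ - p * w₂)]
  -- In signature `(2, 1)` the Gram determinant of three vectors is minus the square of their
  -- determinant, hence nonpositive.
  have gram : (x * (v₁ * w₂ - v₂ * w₁) + y * (v₂ * w₀ - v₀ * w₂) + p * (v₀ * w₁ - v₁ * w₀)) ^ 2
      = -((x ^ 2 + y ^ 2 - p ^ 2) * (v₀ ^ 2 + v₁ ^ 2 - v₂ ^ 2) * (w₀ ^ 2 + w₁ ^ 2 - w₂ ^ 2)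
        + 2 * (x * v₀ + y * v₁ - p * v₂) * (x * w₀ + y * w₁ - p * w₂)
          * (v₀ * w₀ + v₁ * w₁ - v₂ * w₂)
        - (x ^ 2 + y ^ 2 - p ^ 2) * (v₀ * w₀ + v₁ * w₁ - v₂ * w₂) ^ 2
        - (v₀ ^ 2 + v₁ ^ 2 - v₂ ^ 2) * (x * w₀ + y * w₁ - p * w₂) ^ 2
        - (w₀ ^ 2 + w₁ ^ 2 - w₂ ^ 2) * (x * v₀ + y * v₁ - p * v₂) ^ 2) := by ring
  rw [hv, hw, hvw] at gram
  have h := sq_nonneg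
    (x * (v₁ * w₂ - v₂ * w₁) + y * (v₂ * w₀ - v₀ * w₂) + p * (v₀ * w₁ - v₁ * w₀))
  rw [gram] at h
  have := nonneg_of_mul_nonneg_right (b := (x * v₀ + y * v₁ - p * v₂) ^ 2
    + (x * w₀ + y * w₁ - p * w₂) ^ 2 - l * (x ^ 2 + y ^ 2 - p ^ 2)) (by linarith) hl
  linarith

end LinearAlgebra

/-! ### Minimal conformal immersions are harmonic. -/

section ConformalImmersion

variable {X : ℂ → E3} {z : ℂ}

theorem inner_eq_coord (x y : E3) : inner ℝ x y = x 0 * y 0 + x 1 * y 1 + x 2 * y 2 := by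
  simp [PiLp.inner_apply, Fin.sum_univ_three, mul_comm]

theorem conformal_frame (h : ConformalAt X z) :
    0 < inner ℝ (partialU X z) (partialU X z) ∧
      inner ℝ (partialV X z) (partialV X z) = inner ℝ (partialU X z) (partialU X z) ∧
      inner ℝ (partialU X z) (partialV X z) = 0 := by
  obtain ⟨c, hc, h⟩ := conformalAt_iff'.mp h
  simp only [partialU, partialV, h]
  simp [Complex.inner, hc]

/-- A conformal immersion with zero mean curvature is harmonic. -/
theorem laplacian_eq_zero_of_minimal {ν : E3} (hX : ContDiffAt ℝ 2 X z)
    (hconf : ∀ᶠ w in 𝓝 z, ConformalAt X w) (hν : IsUnitNormal X z ν)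
    (hmin : meanCurvature X z ν = 0) (i : Fin 3) :
    fderiv ℝ (fderiv ℝ X) z 1 1 i + fderiv ℝ (fderiv ℝ X) z Complex.I Complex.I i = 0 := by
  obtain ⟨hE, hG, hF⟩ := conformal_frame hconf.self_of_nhds
  have hsymm := (hX.isSymmSndFDerivAt (by simp)).eq 1 Complex.I
  -- Differentiating `|X_u|² = |X_v|²` here, and `⟨X_u, X_v⟩ = 0` in `diffF`, shows that `ΔX` is
  -- orthogonal to the tangent plane; zero mean curvature (`hH`) removes the normal component.
  have diffE : ∀ v : ℂ, inner ℝ (partialV X z) (fderiv ℝ (fderiv ℝ X) z v Complex.I)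
      = inner ℝ (partialU X z) (fderiv ℝ (fderiv ℝ X) z v 1) := by
    intro v
    have h1 := (hasDerivAt_fderiv_line hX v Complex.I).inner ℝ
      (hasDerivAt_fderiv_line hX v Complex.I)
    have h2 := (hasDerivAt_fderiv_line hX v 1).inner ℝ (hasDerivAt_fderiv_line hX v 1)
    have heq := h1.congr_of_eventuallyEq (f₁ := fun t : ℝ =>
        inner ℝ (fderiv ℝ X (z + t • v) 1) (fderiv ℝ X (z + t • v) 1)) (by
      filter_upwards [(tendsto_line z v).eventually hconf] with t ht
      exact (conformal_frame ht).2.1.symm)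
    have := heq.unique h2
    simp only [zero_smul, add_zero] at this
    rw [real_inner_comm (fderiv ℝ X z Complex.I), real_inner_comm (fderiv ℝ X z 1)] at this
    simp only [partialU, partialV]
    linarith
  have diffF : ∀ v : ℂ, inner ℝ (partialU X z) (fderiv ℝ (fderiv ℝ X) z v Complex.I)
      + inner ℝ (fderiv ℝ (fderiv ℝ X) z v 1) (partialV X z) = 0 := by
    intro v
    have h1 := (hasDerivAt_fderiv_line hX v 1).inner ℝ (hasDerivAt_fderiv_line hX v Complex.I)
    have heq := (hasDerivAt_const (0 : ℝ) (0 : ℝ)).congr_of_eventuallyEq (f₁ := fun t : ℝ =>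
        inner ℝ (fderiv ℝ X (z + t • v) 1) (fderiv ℝ X (z + t • v) Complex.I)) (by
      filter_upwards [(tendsto_line z v).eventually hconf] with t ht
      exact (conformal_frame ht).2.2)
    simpa [partialU, partialV] using h1.unique heq
  have hH : inner ℝ (fderiv ℝ (fderiv ℝ X) z 1 1) ν
      + inner ℝ (fderiv ℝ (fderiv ℝ X) z Complex.I Complex.I) ν = 0 := by
    simp only [meanCurvature, hF, hG, iteratedFDeriv_two_apply] at hmin
    simp only [Matrix.cons_val_zero, Matrix.cons_val_one] at hmin
    rw [div_eq_zero_iff] at hmin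
    rcases hmin with h | h
    · have : (inner ℝ (fderiv ℝ (fderiv ℝ X) z 1 1) ν
          + inner ℝ (fderiv ℝ (fderiv ℝ X) z Complex.I Complex.I) ν)
          * inner ℝ (partialU X z) (partialU X z) = 0 := by linarith
      exact (mul_eq_zero.mp this).resolve_right hE.ne'
    · nlinarith
  have e1 := diffE 1
  have e2 := diffE Complex.I
  have f1 := diffF 1
  have f2 := diffF Complex.I
  obtain ⟨hν1, hνu, hνv⟩ := hν
  have hνν : inner ℝ ν ν = 1 := by rw [real_inner_self_eq_norm_sq, hν1]; norm_num
  rw [← hsymm] at e2 f2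
  simp only [inner_eq_coord] at e1 e2 f1 f2 hH hνu hνv hνν hE hG hF
  set a := partialU X z
  set b := partialV X z
  set c := fderiv ℝ (fderiv ℝ X) z 1 1
  set d := fderiv ℝ (fderiv ℝ X) z Complex.I Complex.I
  set m := fderiv ℝ (fderiv ℝ X) z 1 Complex.I
  have hdet := tripleProduct_sq (n₀ := ν 0) (n₁ := ν 1) (n₂ := ν 2) (a₀ := a 0) (a₁ := a 1)
    (a₂ := a 2) (b₀ := b 0) (b₁ := b 1) (b₂ := b 2)
    (E := a 0 * a 0 + a 1 * a 1 + a 2 * a 2) (by linarith) hνu hνv (by ring) (by linarith) hF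
  have hdet0 : (ν 0 * (a 1 * b 2 - a 2 * b 1) + ν 1 * (a 2 * b 0 - a 0 * b 2)
      + ν 2 * (a 0 * b 1 - a 1 * b 0)) ≠ 0 := by
    intro h
    rw [h] at hdet
    exact (pow_pos hE 2).ne' (by rw [← hdet]; norm_num)
  have la : (c 0 + d 0) * a 0 + (c 1 + d 1) * a 1 + (c 2 + d 2) * a 2 = 0 := by linarith
  have lb : (c 0 + d 0) * b 0 + (c 1 + d 1) * b 1 + (c 2 + d 2) * b 2 = 0 := by linarith
  have ln : (c 0 + d 0) * ν 0 + (c 1 + d 1) * ν 1 + (c 2 + d 2) * ν 2 = 0 := by linarith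
  -- Cramer's rule: `ΔX` is orthogonal to the basis `ν, a, b`, and the coefficients below are
  -- cofactors.
  refine (mul_eq_zero.mp ?_).resolve_right hdet0
  fin_cases i
  · simp only [Fin.zero_eta]
    linear_combination (a 1 * b 2 - a 2 * b 1) * ln + (b 1 * ν 2 - b 2 * ν 1) * la
      + (ν 1 * a 2 - ν 2 * a 1) * lb
  · simp only [Fin.mk_one]
    linear_combination (a 2 * b 0 - a 0 * b 2) * ln + (b 2 * ν 0 - b 0 * ν 2) * la
      + (ν 2 * a 0 - ν 0 * a 2) * lb
  · simp only [Fin.reduceFinMk]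
    linear_combination (a 0 * b 1 - a 1 * b 0) * ln + (b 0 * ν 1 - b 1 * ν 0) * la
      + (ν 0 * a 1 - ν 1 * a 0) * lb

end ConformalImmersion

/-! ### The conjugate height and superharmonicity of `log q`. -/

section Conjugate

variable {X n : ℂ → E3} {p : ℂ → ℝ} {z : ℂ}

/-- The third coordinate of a conformal immersion and a primitive of `N₂ dX₁ - N₁ dX₂` are
conjugate up to a locally constant sign. -/
theorem exists_conjugate_sign (hX : ContDiffAt ℝ 2 X z) (hconf : ∀ᶠ w in 𝓝 z, ConformalAt X w)
    (hn : ∀ᶠ w in 𝓝 z, IsUnitNormal X w (n w)) (hnc : ContinuousAt n z)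
    (hp : ∀ᶠ w in 𝓝 z, HasFDerivAt p (n w 1 • fderiv ℝ (fun y => X y 0) w
      - n w 0 • fderiv ℝ (fun y => X y 1) w) w) :
    ∃ s : ℝ, s ^ 2 = 1 ∧ ∀ᶠ w in 𝓝 z, ∃ L : ℂ →L[ℝ] ℝ, HasFDerivAt p L w ∧
      L 1 = -s * fderiv ℝ X w Complex.I 2 ∧ L Complex.I = s * fderiv ℝ X w 1 2 := by
  set a : ℂ → E3 := fun w => fderiv ℝ X w 1 with ha
  set b : ℂ → E3 := fun w => fderiv ℝ X w Complex.I with hb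
  have hfc : ContinuousAt (fderiv ℝ X) z :=
    (hX.fderiv_right (m := 1) (by norm_num)).continuousAt
  have hac : ContinuousAt a z := hfc.clm_apply continuousAt_const
  have hbc : ContinuousAt b z := hfc.clm_apply continuousAt_const
  have coord : ∀ {f : ℂ → E3}, ContinuousAt f z → ∀ i, ContinuousAt (fun w => f w i) z :=
    fun hf i => (EuclideanSpace.proj i : E3 →L[ℝ] ℝ).continuous.continuousAt.comp hf
  -- The orientation of `(n, a, b)`: continuous with values `±1`, hence locally constant. Since `n`
  -- is only continuous, this is what makes the derivative of `p` differentiable.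
  set σ : ℂ → ℝ := fun w => (n w 0 * (a w 1 * b w 2 - a w 2 * b w 1)
    + n w 1 * (a w 2 * b w 0 - a w 0 * b w 2) + n w 2 * (a w 0 * b w 1 - a w 1 * b w 0))
    / inner ℝ (a w) (a w) with hσ
  have hE : inner ℝ (a z) (a z) ≠ (0 : ℝ) := (conformal_frame hconf.self_of_nhds).1.ne'
  have hσc : ContinuousAt σ z := by
    have hn' := coord hnc
    have ha' := coord hac
    have hb' := coord hbc
    refine ContinuousAt.div ?_ (hac.inner hac) hE
    exact (((hn' 0).mul (((ha' 1).mul (hb' 2)).sub ((ha' 2).mul (hb' 1)))).add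
      ((hn' 1).mul (((ha' 2).mul (hb' 0)).sub ((ha' 0).mul (hb' 2))))).add
      ((hn' 2).mul (((ha' 0).mul (hb' 1)).sub ((ha' 1).mul (hb' 0))))
  have pointwise : ∀ w, ConformalAt X w → IsUnitNormal X w (n w) → σ w ^ 2 = 1 ∧
      n w 0 * a w 1 - n w 1 * a w 0 = σ w * b w 2 ∧
      n w 0 * b w 1 - n w 1 * b w 0 = -σ w * a w 2 := by
    intro w hw hnw
    obtain ⟨hE, hG, hF⟩ := conformal_frame hw
    obtain ⟨hn1, hnu, hnv⟩ := hnw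
    have hnn : inner ℝ (n w) (n w) = 1 := by rw [real_inner_self_eq_norm_sq, hn1]; norm_num
    change 0 < inner ℝ (a w) (a w) at hE
    change inner ℝ (b w) (b w) = inner ℝ (a w) (a w) at hG
    change inner ℝ (a w) (b w) = 0 at hF
    change inner ℝ (n w) (a w) = 0 at hnu
    change inner ℝ (n w) (b w) = 0 at hnv
    have hdet : n w 0 * (a w 1 * b w 2 - a w 2 * b w 1)
        + n w 1 * (a w 2 * b w 0 - a w 0 * b w 2) + n w 2 * (a w 0 * b w 1 - a w 1 * b w 0)
        = σ w * inner ℝ (a w) (a w) := by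
      rw [hσ]; field_simp
    have hEE : inner ℝ (a w) (a w) = a w 0 ^ 2 + a w 1 ^ 2 + a w 2 ^ 2 := by
      rw [inner_eq_coord]; ring
    rw [hEE] at hE hdet hG
    rw [inner_eq_coord] at hnn hG hF hnu hnv
    have hsq := tripleProduct_sq (by linarith) hnu hnv rfl (by linarith) hF
    rw [hdet] at hsq
    have hσ1 : σ w ^ 2 = 1 := by
      rw [mul_pow] at hsq
      exact mul_right_cancel₀ (pow_pos hE 2).ne' (by rw [hsq, one_mul])
    refine ⟨hσ1, cross_vertical (by linarith) hnu rfl (by linarith) hσ1 hdet, ?_⟩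
    -- Exchanging the two frame vectors reverses the orientation sign.
    exact cross_vertical (b₀ := a w 0) (b₁ := a w 1) (by linarith) hnv (by linarith) rfl
      (by linarith) (by linarith)
  refine ⟨σ z, (pointwise z hconf.self_of_nhds hn.self_of_nhds).1, ?_⟩
  have hz := (pointwise z hconf.self_of_nhds hn.self_of_nhds).1
  have hclose : ∀ᶠ w in 𝓝 z, |σ w - σ z| < 1 := by
    simpa [Real.dist_eq] using Metric.continuousAt_iff'.mp hσc 1 one_pos
  filter_upwards [hconf, hn, hp, hclose, eventually_differentiableAt hX] with w h1 h2 h3 h4 h5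
  obtain ⟨k1, k2, k3⟩ := pointwise w h1 h2
  have hσw : σ w = σ z := by
    rcases sq_eq_one_iff.mp k1 with h | h <;>
      rcases sq_eq_one_iff.mp hz with h' | h' <;>
      rw [h, h'] at h4 ⊢ <;> norm_num at h4
  rw [hσw] at k2 k3
  refine ⟨_, h3, ?_, ?_⟩
  · simp only [sub_apply, smul_apply, smul_eq_mul,
      fderiv_coord h5]
    linarith
  · simp only [sub_apply, smul_apply, smul_eq_mul,
      fderiv_coord h5]
    linarith

/-- On a conformal minimal immersion with conjugate height `p`, the function
`g - δ log (X₁² + X₂² - p²) + η (X₁² + X₂²)`, with `g` harmonic, is strictly subharmonic: it has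
no local maximum. -/
theorem not_isLocalMax_sub_log {g : ℂ → ℝ} {δ η : ℝ} (hX : ContDiffAt ℝ 2 X z)
    (hconf : ∀ᶠ w in 𝓝 z, ConformalAt X w)
    (hn : ∀ᶠ w in 𝓝 z, IsUnitNormal X w (n w)) (hnc : ContinuousAt n z)
    (hmin : meanCurvature X z (n z) = 0)
    (hp : ∀ᶠ w in 𝓝 z, HasFDerivAt p (n w 1 • fderiv ℝ (fun y => X y 0) w
      - n w 0 • fderiv ℝ (fun y => X y 1) w) w)
    (hg : InnerProductSpace.HarmonicAt g z) (hq : 0 < X z 0 ^ 2 + X z 1 ^ 2 - p z ^ 2)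
    (hδ : 0 ≤ δ) (hη : 0 < η) :
    ¬ IsLocalMax (fun w => g w - δ * Real.log (X w 0 ^ 2 + X w 1 ^ 2 - p w ^ 2)
      + η * (X w 0 ^ 2 + X w 1 ^ 2)) z := by
  intro hmax
  obtain ⟨s, hs, hsp⟩ := exists_conjugate_sign hX hconf hn hnc hp
  have hlap := laplacian_eq_zero_of_minimal hX hconf hn.self_of_nhds hmin
  have hglap : fderiv ℝ (fderiv ℝ g) z 1 1 + fderiv ℝ (fderiv ℝ g) z Complex.I Complex.I = 0 := by
    have := hg.2.self_of_nhds
    rw [InnerProductSpace.laplacian_eq_iteratedFDeriv_complexPlane] at this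
    simpa [iteratedFDeriv_two_apply] using this
  have hsymm := (hX.isSymmSndFDerivAt (by simp)).eq 1 Complex.I
  obtain ⟨hE, hG, hF⟩ := conformal_frame hconf.self_of_nhds
  simp only [partialU, partialV, inner_eq_coord] at hE hG hF
  -- Second-derivative test along the line in direction `v`. The jet of `p` is an input, supplied
  -- below by conjugacy: `p_u = -s X₃_v`, `p_v = s X₃_u`, so that `p_uu + p_vv = 0`.
  have jet : ∀ (v : ℂ) (p₁ p₂ : ℝ), HasTwoJet (fun t => p (z + t • v)) p₁ p₂ →
      fderiv ℝ (fderiv ℝ g) z v v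
        - δ * ((2 * (fderiv ℝ X z v 0 ^ 2 + X z 0 * fderiv ℝ (fderiv ℝ X) z v v 0)
            + 2 * (fderiv ℝ X z v 1 ^ 2 + X z 1 * fderiv ℝ (fderiv ℝ X) z v v 1)
            - 2 * (p₁ ^ 2 + p z * p₂)) * (X z 0 ^ 2 + X z 1 ^ 2 - p z ^ 2)
          - (2 * (X z 0 * fderiv ℝ X z v 0) + 2 * (X z 1 * fderiv ℝ X z v 1)
            - 2 * (p z * p₁)) ^ 2) / (X z 0 ^ 2 + X z 1 ^ 2 - p z ^ 2) ^ 2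
        + η * (2 * (fderiv ℝ X z v 0 ^ 2 + X z 0 * fderiv ℝ (fderiv ℝ X) z v v 0)
            + 2 * (fderiv ℝ X z v 1 ^ 2 + X z 1 * fderiv ℝ (fderiv ℝ X) z v v 1)) ≤ 0 := by
    intro v p₁ p₂ hjp
    have j0 := (hasTwoJet_coord_line hX v 0).sq
    have j1 := (hasTwoJet_coord_line hX v 1).sq
    have jq := (j0.add j1).sub hjp.sq
    have j := ((hasTwoJet_line hg.1 v).sub ((jq.log (by simpa using hq.ne')).const_mul δ)).add
      ((j0.add j1).const_mul η)
    have := j.nonpos_of_isLocalMax (by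
      have h : IsLocalMax ((fun w => g w - δ * Real.log (X w 0 ^ 2 + X w 1 ^ 2 - p w ^ 2)
        + η * (X w 0 ^ 2 + X w 1 ^ 2)) ∘ fun t : ℝ => z + t • v) 0 :=
        IsMaxFilter.comp_tendsto (l := 𝓝 z) (by simpa [IsLocalMax] using hmax) (tendsto_line z v)
      exact h)
    simpa [mul_div_assoc] using this
  have ju := jet 1 (-s * fderiv ℝ X z Complex.I 2) (-s * fderiv ℝ (fderiv ℝ X) z 1 Complex.I 2)
    ⟨fun t => -s * fderiv ℝ X (z + t • 1) Complex.I 2, by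
      filter_upwards [(tendsto_line z 1).eventually hsp] with t ⟨L, h1, h2, h3⟩
      exact h2 ▸ hasDerivAt_comp_line 1 t h1, by simp,
      (hasDerivAt_coord (hasDerivAt_fderiv_line hX 1 Complex.I) 2).const_mul _⟩
  have jv := jet Complex.I (s * fderiv ℝ X z 1 2) (s * fderiv ℝ (fderiv ℝ X) z Complex.I 1 2)
    ⟨fun t => s * fderiv ℝ X (z + t • Complex.I) 1 2, by
      filter_upwards [(tendsto_line z Complex.I).eventually hsp] with t ⟨L, h1, h2, h3⟩
      exact h3 ▸ hasDerivAt_comp_line Complex.I t h1, by simp,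
      (hasDerivAt_coord (hasDerivAt_fderiv_line hX Complex.I 1) 2).const_mul _⟩
  rw [← hsymm] at jv
  have l0 := hlap 0
  have l1 := hlap 1
  clear jet hlap hsymm hsp
  set q := X z 0 ^ 2 + X z 1 ^ 2 - p z ^ 2 with hqdef
  generalize fderiv ℝ (fderiv ℝ X) z 1 Complex.I 2 = m at *
  generalize fderiv ℝ (fderiv ℝ X) z 1 1 = c at *
  generalize fderiv ℝ (fderiv ℝ X) z Complex.I Complex.I = d at *
  generalize fderiv ℝ X z 1 = a at *
  generalize fderiv ℝ X z Complex.I = b at *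
  generalize fderiv ℝ (fderiv ℝ g) z 1 1 = g₁ at *
  generalize fderiv ℝ (fderiv ℝ g) z Complex.I Complex.I = g₂ at *
  have hvert := conformal_vertical_le (E := a 0 * a 0 + a 1 * a 1 + a 2 * a 2) hE (by ring)
    (by linarith) hF
  -- The two frame vectors are the partial derivatives of `(X₁, X₂, p)`.
  have htan := lorentz_tangent_ge (x := X z 0) (y := X z 1) (p := p z)
    (v₀ := a 0) (v₁ := a 1) (v₂ := -s * b 2) (w₀ := b 0) (w₁ := b 1) (w₂ := s * a 2)
    (l := a 0 * a 0 + a 1 * a 1 + a 2 * a 2 - (a 2 ^ 2 + b 2 ^ 2)) (by linarith)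
    (by linear_combination -b 2 ^ 2 * hs) (by linear_combination hG - a 2 ^ 2 * hs)
    (by linear_combination hF + a 2 * b 2 * hs)
  rw [← hqdef] at htan
  -- This says `q Δq - |∇q|² ≤ 0`, the numerator of `Δ log q`.
  have hnum : ((2 * (a 0 ^ 2 + X z 0 * c 0) + 2 * (a 1 ^ 2 + X z 1 * c 1)
        - 2 * ((-s * b 2) ^ 2 + p z * (-s * m))) * q
      - (2 * (X z 0 * a 0) + 2 * (X z 1 * a 1) - 2 * (p z * (-s * b 2))) ^ 2)
      + ((2 * (b 0 ^ 2 + X z 0 * d 0) + 2 * (b 1 ^ 2 + X z 1 * d 1)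
        - 2 * ((s * a 2) ^ 2 + p z * (s * m))) * q
      - (2 * (X z 0 * b 0) + 2 * (X z 1 * b 1) - 2 * (p z * (s * a 2))) ^ 2) ≤ 0 := by
    have e : (2 * (a 0 ^ 2 + X z 0 * c 0) + 2 * (a 1 ^ 2 + X z 1 * c 1)
        - 2 * ((-s * b 2) ^ 2 + p z * (-s * m)))
        + (2 * (b 0 ^ 2 + X z 0 * d 0) + 2 * (b 1 ^ 2 + X z 1 * d 1)
        - 2 * ((s * a 2) ^ 2 + p z * (s * m)))
        = 4 * (a 0 * a 0 + a 1 * a 1 + a 2 * a 2 - (a 2 ^ 2 + b 2 ^ 2)) := by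
      linear_combination 2 * X z 0 * l0 + 2 * X z 1 * l1 + 2 * hG
        - 2 * (a 2 ^ 2 + b 2 ^ 2) * hs
    linear_combination q * e + 4 * htan
  have hlog := mul_nonpos_of_nonneg_of_nonpos hδ
    (div_nonpos_of_nonpos_of_nonneg hnum (sq_nonneg q))
  -- `Δ(X₁² + X₂²) = 2(2E - a₂² - b₂²) ≥ 2E > 0`.
  have hpert : 0 < η * (2 * (a 0 ^ 2 + X z 0 * c 0) + 2 * (a 1 ^ 2 + X z 1 * c 1)
      + (2 * (b 0 ^ 2 + X z 0 * d 0) + 2 * (b 1 ^ 2 + X z 1 * d 1))) := by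
    refine mul_pos hη ?_
    have : 2 * (a 0 ^ 2 + X z 0 * c 0) + 2 * (a 1 ^ 2 + X z 1 * c 1)
      + (2 * (b 0 ^ 2 + X z 0 * d 0) + 2 * (b 1 ^ 2 + X z 1 * d 1))
      = 2 * (2 * (a 0 * a 0 + a 1 * a 1 + a 2 * a 2) - (a 2 ^ 2 + b 2 ^ 2)) := by
      linear_combination 2 * X z 0 * l0 + 2 * X z 1 * l1 + 2 * hG
    linarith
  rw [mul_div_assoc] at ju jv
  rw [add_div, mul_add] at hlog
  linarith

end Conjugate

/-! ### Transfer to the surface and the maximum principle. -/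

section Surface

variable {M : Type*} [TopologicalSpace M] [ChartedSpace ℂ M]

theorem norm_horizontalProj_sq (x : E3) : ‖horizontalProj x‖ ^ 2 = x 0 ^ 2 + x 1 ^ 2 := by
  simp [EuclideanSpace.norm_sq_eq, horizontalProj, Fin.sum_univ_two]

/-- The interior of a conformal minimal immersion carries no local maximum of
`f - δ log (Y₁² + Y₂² - Q²) + η (Y₁² + Y₂²)` with `f` harmonic and `Q` a primitive of `ψ`. -/
theorem not_isLocalMax_surface {U : Set M} (hUo : IsOpen U) {Y N : M → E3} {Q f : M → ℝ}
    (hY : IsConformalMinimalImmersion U Y) (hN : IsGaussMap U Y N) (hQ : IsPrimitivePsi U Y N Q)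
    (hf : IsHarmonicOn f U) {p : M} (hp : p ∈ U) (hq : 0 < Y p 0 ^ 2 + Y p 1 ^ 2 - Q p ^ 2)
    {δ η : ℝ} (hδ : 0 ≤ δ) (hη : 0 < η) :
    ¬ IsLocalMax (fun x => f x - δ * Real.log (Y x 0 ^ 2 + Y x 1 ^ 2 - Q x ^ 2)
      + η * (Y x 0 ^ 2 + Y x 1 ^ 2)) p := by
  intro hmax
  set e := chartAt ℂ p
  have he : e ∈ atlas ℂ M := chart_mem_atlas ℂ p
  have hps : p ∈ e.source := mem_chart_source ℂ p
  have hpe : e.symm (e p) = p := e.left_inv hps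
  have hcont : ContinuousAt e.symm (e p) := e.continuousAt_symm (e.map_source hps)
  have hV : e.target ∩ e.symm ⁻¹' U ∈ 𝓝 (e p) :=
    (e.isOpen_inter_preimage_symm hUo).mem_nhds ⟨e.map_source hps, by simpa [hpe] using hp⟩
  have hpt : ∀ w ∈ e.target ∩ e.symm ⁻¹' U, e.symm w ∈ e.source ∩ U ∧ e (e.symm w) = w :=
    fun w hw => ⟨⟨e.map_target hw.1, hw.2⟩, e.right_inv hw.1⟩
  refine not_isLocalMax_sub_log (X := Y ∘ e.symm) (n := N ∘ e.symm) (p := Q ∘ e.symm)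
    (g := f ∘ e.symm) (z := e p) (δ := δ) (η := η)
    (((hY.smooth e he).contDiffAt hV).of_le (by norm_cast)) ?_ ?_ ?_ ?_ ?_
    (hf e he p ⟨hps, hp⟩) ?_ hδ hη ?_
  · filter_upwards [hV] with w hw
    simpa [(hpt w hw).2] using hY.conformal e he _ (hpt w hw).1
  · filter_upwards [hV] with w hw
    simpa [(hpt w hw).2] using hN.unitNormal e he _ (hpt w hw).1
  · exact ContinuousAt.comp (by rw [hpe]; exact hN.continuousOn.continuousAt (hUo.mem_nhds hp))
      hcont
  · simpa [hpe] using hY.minimal e he p ⟨hps, hp⟩ _ (hN.unitNormal e he p ⟨hps, hp⟩)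
  · filter_upwards [hV] with w hw
    simpa [(hpt w hw).2, psi] using hQ.hasFDerivAt e he _ (hpt w hw).1
  · simpa [hpe] using hq
  · exact IsMaxFilter.comp_tendsto (by rw [hpe]; exact hmax) hcont.tendsto

/-- Maximum principle: under the growth bound, a bounded harmonic function that is nonpositive on
the boundary is nonpositive. -/
theorem nonpos_of_frontier_nonpos {U : Set M} (hUo : IsOpen U) {Y N : M → E3} {Q f : M → ℝ}
    (hY : IsConformalMinimalImmersion U Y)
    (hproper : IsProperMap (fun p : closure U => horizontalProj (Y p)))
    (hN : IsGaussMap U Y N) (hQ : IsPrimitivePsi U Y N Q) {ε : ℝ} (hε : 0 < ε)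
    (hbound : ∀ p ∈ closure U, |Q p| ≤ ‖horizontalProj (Y p)‖ - ε)
    (hfc : ContinuousOn f (closure U)) {B : ℝ} (hB : ∀ p ∈ closure U, f p ≤ B)
    (hf : IsHarmonicOn f U) (hf0 : ∀ p ∈ frontier U, f p ≤ 0) : ∀ p ∈ closure U, f p ≤ 0 := by
  intro p₁ hp₁
  by_contra! hpos
  set r : M → ℝ := fun p => ‖horizontalProj (Y p)‖ with hr
  set q : M → ℝ := fun p => Y p 0 ^ 2 + Y p 1 ^ 2 - Q p ^ 2 with hqdef
  have hq_ge : ∀ p ∈ closure U, 2 * ε * r p - ε ^ 2 ≤ q p := by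
    intro p hp
    have h1 := hbound p hp
    have h2 : Q p ^ 2 ≤ (r p - ε) ^ 2 := sq_le_sq' (by linarith [neg_abs_le (Q p)])
      ((le_abs_self _).trans h1)
    have h3 := norm_horizontalProj_sq (Y p)
    simp only [hqdef, ← h3]
    nlinarith
  have hr_ge : ∀ p ∈ closure U, ε ≤ r p := fun p hp => by
    linarith [hbound p hp, abs_nonneg (Q p)]
  have hqε : ∀ p ∈ closure U, ε ^ 2 ≤ q p := fun p hp => by
    nlinarith [hq_ge p hp, hr_ge p hp]
  have hq_pos : ∀ p ∈ closure U, 0 < q p := fun p hp => (pow_pos hε 2).trans_le (hqε p hp)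
  set k : M → ℝ := fun p => Real.log (q p) - Real.log (ε ^ 2) with hk
  have hk0 : ∀ p ∈ closure U, 0 ≤ k p := fun p hp =>
    sub_nonneg.mpr (Real.log_le_log (pow_pos hε 2) (hqε p hp))
  obtain ⟨δ, hδ, hδp⟩ : ∃ δ : ℝ, 0 < δ ∧ 0 < f p₁ - δ * k p₁ := by
    refine ⟨f p₁ / (2 * (k p₁ + 1)), div_pos hpos (by linarith [hk0 p₁ hp₁]), ?_⟩
    have h := hk0 p₁ hp₁
    rw [sub_pos, div_mul_eq_mul_div, div_lt_iff₀ (by linarith)]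
    nlinarith
  obtain ⟨R, hR⟩ : ∃ R : ℝ, ∀ p ∈ closure U, R ≤ r p → f p - δ * k p ≤ 0 := by
    -- `R` solves `2εR - ε² = exp (B / δ + log ε²)`, so `r ≥ R` forces `δ k ≥ B ≥ f`.
    refine ⟨(Real.exp (B / δ + Real.log (ε ^ 2)) + ε ^ 2) / (2 * ε), fun p hp hrp => ?_⟩
    rw [div_le_iff₀ (by linarith)] at hrp
    have h1 : Real.exp (B / δ + Real.log (ε ^ 2)) ≤ q p := by linarith [hq_ge p hp]
    have h2 : B / δ ≤ k p := by
      have := (Real.le_log_iff_exp_le (hq_pos p hp)).mpr h1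
      simp only [hk]; linarith
    rw [div_le_iff₀ hδ] at h2
    linarith [hB p hp]
  -- On `r ≤ R` the perturbation stays below the positive value at `p₁`, so a maximum of `H` still
  -- has `f - δ k > 0`. This keeps it off `r = R` and off the frontier.
  obtain ⟨η, hη, hηm⟩ : ∃ η : ℝ, 0 < η ∧ η * R ^ 2 < f p₁ - δ * k p₁ := by
    refine ⟨(f p₁ - δ * k p₁) / (R ^ 2 + 1), by positivity, ?_⟩
    rw [div_mul_eq_mul_div, div_lt_iff₀ (by positivity)]
    nlinarith
  set H : M → ℝ := fun p => f p - δ * Real.log (q p) + η * (Y p 0 ^ 2 + Y p 1 ^ 2) with hH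
  have hHk : ∀ p, H p = f p - δ * k p + η * r p ^ 2 - δ * Real.log (ε ^ 2) := fun p => by
    simp only [hH, hk, hr, norm_horizontalProj_sq]; ring
  have hHc : ContinuousOn H (closure U) := by
    have coord : ∀ i : Fin 3, ContinuousOn (fun p => Y p i) (closure U) := fun i =>
      (EuclideanSpace.proj i : E3 →L[ℝ] ℝ).continuous.comp_continuousOn hY.continuousOn
    have h01 := ((coord 0).pow 2).add ((coord 1).pow 2)
    exact (hfc.sub (continuousOn_const.mul ((h01.sub (hQ.continuousOn.pow 2)).log
      fun p hp => (hq_pos p hp).ne'))).add (continuousOn_const.mul h01)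
  have hK := hproper.isCompact_preimage
    (isCompact_closedBall (0 : EuclideanSpace ℝ (Fin 2)) R)
  have hmemK : ∀ p : closure U, p ∈ (fun p : closure U => horizontalProj (Y p)) ⁻¹'
      Metric.closedBall 0 R ↔ r p ≤ R := fun p => by simp [hr]
  have hp₁R : r p₁ < R := by
    by_contra! h
    linarith [hR p₁ hp₁ h]
  obtain ⟨⟨p₂, hp₂⟩, hp₂K, hp₂max⟩ := hK.exists_isMaxOn ⟨⟨p₁, hp₁⟩, (hmemK _).mpr hp₁R.le⟩
    (continuousOn_iff_continuous_domRestrict.mp hHc).continuousOn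
  rw [hmemK] at hp₂K
  have hmax : ∀ p ∈ closure U, r p ≤ R → H p ≤ H p₂ := fun p hp hpR =>
    hp₂max (a := ⟨p, hp⟩) ((hmemK _).mpr hpR)
  have hp₂pos : 0 < f p₂ - δ * k p₂ := by
    have h1 := hmax p₁ hp₁ hp₁R.le
    rw [hHk, hHk] at h1
    have h2 : r p₂ ^ 2 ≤ R ^ 2 := pow_le_pow_left₀ (norm_nonneg _) hp₂K 2
    have h3 := mul_le_mul_of_nonneg_left h2 hη.le
    have h4 := mul_nonneg hη.le (sq_nonneg (r p₁))
    linarith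
  have hp₂R : r p₂ < R := by
    by_contra! h
    linarith [hR p₂ hp₂ h]
  have hp₂U : p₂ ∈ U := by
    by_contra h
    have hfr : p₂ ∈ frontier U := ⟨hp₂, by rwa [hUo.interior_eq]⟩
    linarith [hf0 p₂ hfr, mul_nonneg hδ.le (hk0 p₂ hp₂)]
  refine not_isLocalMax_surface hUo hY hN hQ hf hp₂U (hq_pos p₂ hp₂) hδ.le hη ?_
  have hrc : ContinuousAt r p₂ := by
    have h1 : ContinuousOn (fun p => horizontalProj (Y p)) U := by
      rw [continuousOn_iff_continuous_domRestrict]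
      exact hproper.continuous.comp (continuous_inclusion subset_closure)
    exact (h1.continuousAt (hUo.mem_nhds hp₂U)).norm
  filter_upwards [hUo.mem_nhds hp₂U, hrc.eventually_lt_const hp₂R] with p hpU hpR
  exact hmax p (subset_closure hpU) hpR.le

end Surface

end BorderedSurface

/-! ### The theorem: the maximum principle for `f` and `-f`. -/

theorem mainTheorem6 {M : Type*} [TopologicalSpace M] [T2Space M] [ChartedSpace ℂ M]
    [IsManifold 𝓘(ℂ) ω M]
    (U : Set M) (hUo : IsOpen U) (hUc : IsConnected U) (hbd : (frontier U).Nonempty)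
    (Y : M → BorderedSurface.E3) (hY : BorderedSurface.IsConformalMinimalImmersion U Y)
    (hproper : IsProperMap (fun p : closure U => BorderedSurface.horizontalProj (Y p)))
    (N : M → BorderedSurface.E3) (hN : BorderedSurface.IsGaussMap U Y N)
    (P : M → ℝ) (hP : BorderedSurface.IsPrimitivePsi U Y N P)
    (p₀ : M) (hp₀ : p₀ ∈ U) (ε : ℝ) (hε : 0 < ε) (C : ℝ)
    (hbound : ∀ p ∈ closure U,
      |(P p - P p₀) + C| ≤ ‖BorderedSurface.horizontalProj (Y p)‖ - ε) :
    BorderedSurface.IsRelativeParabolic U := by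
  intro f hfc ⟨B, hB⟩ hf hf0 p hp
  -- The constant `C` is absorbed into the primitive, so the growth bound applies to `Q` itself.
  have hQ : BorderedSurface.IsPrimitivePsi U Y N (fun x => (P x - P p₀) + C) :=
    ⟨(hP.continuousOn.sub continuousOn_const).add continuousOn_const,
      fun e he x hx => ((hP.hasFDerivAt e he x hx).sub_const _).add_const _⟩
  have upper := BorderedSurface.nonpos_of_frontier_nonpos hUo hY hproper hN hQ hε hbound hfc
    (fun x hx => (le_abs_self _).trans (hB x hx)) hf (fun x hx => (hf0 x hx).le) p hp
  have lower := BorderedSurface.nonpos_of_frontier_nonpos hUo hY hproper hN hQ hε hbound hfc.neg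
    (fun x hx => (neg_le_abs _).trans (hB x hx)) (fun e he x hx => (hf e he x hx).neg)
    (fun x hx => by simp [hf0 x hx]) p hp
  exact le_antisymm upper (by simpa using lower)
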